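/- Let $n,T\ge 1$ and let $g_1,\dots,g_T$ be unitary gates, each acting on three distinct qubits out of $n$. Write $G_i=g_i\otimes I$ for the expansion of $g_i$ to $n$ qubits, and let $A=|0^n\rangle\langle 0^n|\,G_T\cdots G_1$. Put $$K=\frac1{10\cdot 2^n},\qquad \chi=60^{12}T^9,\qquad \mu=\frac{K}{4\chi^T},\qquad \xi=\frac{\mu}{2^{2n+11}\,T}.$$ Let $\widehat U(2)$ be the distribution of $$u=\begin{pmatrix}\cos\theta\, e^{i\varphi_1}&\sin\theta\, e^{i\varphi_2}\\-\sin\theta\, e^{-i\varphi_2}&\cos\theta\, e^{-i\varphi_1}\end{pmatrix}$$ with $\theta,\varphi_1,\varphi_2$ independent and uniform on $\{k\xi : k\in\mathbb N,\ k\xi<2\pi\}$. Fix an arbitrary deterministic rule that assigns to each such angle triple a matrix $\widehat u$ whose entries differ from those of $u$ by at most $\xi$, and for each $i$ an arbitrary matrix $\widehat{g_i^{-1}}$ whose entries differ from those of $g_i^{-1}$ by at most $\xi$. Given $C\in\mathbb C$, in the protocol $\widehat W$ a verifier interacts with a prover as follows. * Round $0$: the prover sends an $8\times 8$ complex matrix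 $M'_0$, and the verifier rejects unless $|C-\mathrm{tr}(M'_0)|\le\mu$. * Round $i$, for $1\le i<T$: the verifier draws independent $u_i^1,u_i^2,u_i^3\sim\widehat U(2)$ (independently of everything before) and reveals their angles. With $\widehat u_i=\widehat{u_i^1}\otimes\widehat{u_i^2}\otimes\widehat{u_i^3}$ on the qubits of $g_i$, the prover sends an $8\times 8$ matrix $M'_i$, and the verifier rejects unless $|\mathrm{tr}(M'_i)-\mathrm{tr}(M'_{i-1}\,\widehat{g_i^{-1}}\,\widehat u_i)|\le\mu$ and all entries of $M'_i$ have absolute value at most $2^n$. * Round $T$: the verifier draws $u_T$ in the same way and accepts if and only if $|\mathrm{tr}(\widehat U_T\cdots\widehat U_1|0^n\rangle\langle 0^n|)-\mathrm{tr}(M'_{T-1}\,\widehat{g_T^{-1}}\,\widehat u_T)|\le\mu$, where $\widehat U_i=\widehat u_i\otimes I$. The prover is arbitrary: it is computationally unbounded, may use private randomness independent of the verifier's choices, and $M'_i$ may depend on all that was revealed in rounds $1,\dots,i$. Claim: if $|\mathrm{tr}(A)-C|\ge K$, then the verifier accepts with probability at most $\frac13$, whatever the prover does. -/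

import Mathlib

open MeasureTheory ProbabilityTheory
open scoped ENNReal

noncomputable section

namespace TopRowProtocol

/-- Operators on three qubits, indexed by computational basis states. -/
abbrev Op3 : Type := Matrix (Fin 3 → Fin 2) (Fin 3 → Fin 2) ℂ

/-- Operators on `n` qubits. -/
abbrev OpN (n : ℕ) : Type := Matrix (Fin n → Fin 2) (Fin n → Fin 2) ℂ

/-! ### The accuracy parameters -/

/-- `K = 1 / (10 * 2 ^ n)`. -/
def gap (n : ℕ) : ℝ := 1 / (10 * 2 ^ n)

/-- `χ = 60 ^ 12 * T ^ 9`. -/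
def chi (T : ℕ) : ℝ := 60 ^ 12 * (T : ℝ) ^ 9

/-- The tolerance `μ = K / (4 * χ ^ T)` of the consistency checks. -/
def tol (n T : ℕ) : ℝ := gap n / (4 * chi T ^ T)

/-- The precision `ξ = μ / (2 ^ (2 n + 11) * T)` of angles and of matrix entries. -/
def prec (n T : ℕ) : ℝ := tol n T / (2 ^ (2 * n + 11) * (T : ℝ))

/-! ### The truncated distribution of single-qubit unitaries -/

/-- The number of `i : ℕ` with `i * ξ < 2 π`. -/
def gridSize (n T : ℕ) : ℕ := ⌈2 * Real.pi / prec n T⌉₊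

/-- The angle `i * ξ`. -/
def gridAngle {n T : ℕ} (i : Fin (gridSize n T)) : ℝ := (i : ℕ) * prec n T

/-- Parameters `(θ, φ₁, φ₂)` of a single-qubit unitary, each an angle of the grid. -/
abbrev QubitCoins (n T : ℕ) : Type :=
  Fin (gridSize n T) × Fin (gridSize n T) × Fin (gridSize n T)

/-- The verifier's choices in one round: one parameter triple for each of three qubits. -/
abbrev RoundCoins (n T : ℕ) : Type := Fin 3 → QubitCoins n T

/-- The verifier's choices in all the rounds `1, …, T`; the index `i` stands for round `i + 1`. -/
abbrev Coins (n T : ℕ) : Type := Fin T → RoundCoins n T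

/-- The single-qubit unitary with angles `θ, φ₁, φ₂`. -/
def qubitUnitary (θ φ₁ φ₂ : ℝ) : Matrix (Fin 2) (Fin 2) ℂ :=
  !![(Real.cos θ : ℂ) * Complex.exp (Complex.I * φ₁),
      (Real.sin θ : ℂ) * Complex.exp (Complex.I * φ₂);
    -(Real.sin θ : ℂ) * Complex.exp (-(Complex.I * φ₂)),
      (Real.cos θ : ℂ) * Complex.exp (-(Complex.I * φ₁))]

/-- The exact single-qubit unitary `u` represented by the sampled parameters. -/
def sampledUnitary {n T : ℕ} (c : QubitCoins n T) : Matrix (Fin 2) (Fin 2) ℂ :=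
  qubitUnitary (gridAngle c.1) (gridAngle c.2.1) (gridAngle c.2.2)

/-- Every entry of `B'` is an approximation of the entry of `B` up to `ξ`. -/
def IsTruncation {ι : Type*} (ξ : ℝ) (B' B : Matrix ι ι ℂ) : Prop :=
  ∀ j k, ‖B' j k - B j k‖ ≤ ξ

/-! ### Circuits and top row matrices -/

/-- A unitary gate on three distinct qubits out of `n`. -/
structure LocalGate (n : ℕ) where
  qubits : Fin 3 ↪ Fin n
  op : Matrix.unitaryGroup (Fin 3 → Fin 2) ℂ

/-- The expansion `b ⊗ I` to `n` qubits of an operator `b` on the qubits `s 0, s 1, s 2`. -/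
def expand {n : ℕ} (s : Fin 3 ↪ Fin n) (b : Op3) : OpN n :=
  fun x y => if ∀ q, (∀ j, s j ≠ q) → x q = y q then
    b (fun j => x (s j)) (fun j => y (s j)) else 0

/-- The tensor product `v 0 ⊗ v 1 ⊗ v 2`. -/
def tensor3 (v : Fin 3 → Matrix (Fin 2) (Fin 2) ℂ) : Op3 :=
  fun a b => ∏ j, v j (a j) (b j)

/-- The projection `|0ⁿ⟩⟨0ⁿ|`. -/
def zeroProj (n : ℕ) : OpN n := Matrix.single 0 0 1

/-- The product `B_T ⋯ B_2 B_1`, where `B_(i+1)` is the value at index `i`. -/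
def descProd {n T : ℕ} (B : Fin T → OpN n) : OpN n := (List.ofFn B).reverse.prod

/-- The top row matrix `A = |0ⁿ⟩⟨0ⁿ| G_T ⋯ G_1` of a circuit. -/
def topRow {n T : ℕ} (g : Fin T → LocalGate n) : OpN n :=
  zeroProj n * descProd (fun i => expand (g i).qubits (g i).op)

/-! ### The protocol -/

/-- A deterministic prover strategy: the message `M'_i` for `0 ≤ i < T`, as a function of what the
verifier revealed in the rounds `1, …, i`. -/
abbrev Strategy (n T : ℕ) : Type := (i : Fin T) → (Fin i → RoundCoins n T) → Op3

/-- The message `M'_i` of the strategy `P` when the verifier's choices are `c`. -/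
def message {n T : ℕ} (P : Strategy n T) (c : Coins n T) (i : Fin T) : Op3 :=
  P i (fun j => c (j.castLE i.isLt.le))

/-- The three-qubit operator `û = û¹ ⊗ û² ⊗ û³` used in a round, where `trunc` truncates
single-qubit unitaries. -/
def roundOp {n T : ℕ} (trunc : QubitCoins n T → Matrix (Fin 2) (Fin 2) ℂ)
    (r : RoundCoins n T) : Op3 :=
  tensor3 (fun j => trunc (r j))

/-- The verifier accepts. Index `i : Fin T` belongs to the gate `g_(i+1)`, its truncated inverse
`gInv i`, the unitary `u_(i+1)` and the message `M'_i`. The three conjuncts are the checks of round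
`0`, of the rounds `1, …, T - 1` (with the bound on the entries), and of round `T`. -/
def Accepts {n T : ℕ} (g : Fin T → LocalGate n) (C : ℂ)
    (trunc : QubitCoins n T → Matrix (Fin 2) (Fin 2) ℂ) (gInv : Fin T → Op3)
    (P : Strategy n T) (c : Coins n T) : Prop :=
  (∀ i : Fin T, (i : ℕ) = 0 → ‖C - (message P c i).trace‖ ≤ tol n T) ∧
  (∀ i j : Fin T, (j : ℕ) = i + 1 →
    ‖(message P c j).trace - (message P c i * gInv i * roundOp trunc (c i)).trace‖ ≤ tol n T ∧
    ∀ a b, ‖message P c j a b‖ ≤ 2 ^ n) ∧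
  (∀ i : Fin T, (i : ℕ) + 1 = T →
    ‖(descProd (fun k => expand (g k).qubits (roundOp trunc (c k))) * zeroProj n).trace
      - (message P c i * gInv i * roundOp trunc (c i)).trace‖ ≤ tol n T)

/-- The probability that the verifier accepts a prover who uses a private random seed with law `ρ`,
the verifier's angles being independent of the seed, and independent and uniform on the grid. -/
def passProb {n T : ℕ} (g : Fin T → LocalGate n) (C : ℂ)
    (trunc : QubitCoins n T → Matrix (Fin 2) (Fin 2) ℂ) (gInv : Fin T → Op3)
    {Ω : Type*} [MeasurableSpace Ω] (ρ : Measure Ω) (P : Ω → Strategy n T) : ℝ≥0∞ :=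
  (ρ.prod (uniformOn (Set.univ : Set (Coins n T))))
    {p | Accepts g C trunc gInv (P p.1) p.2}

end TopRowProtocol

end

/-! Compare the prover with an honest one whose `i`-th message is the partial trace of the hybrid
`B_i ⋯ B_1 |0ⁿ⟩⟨0ⁿ| G_T ⋯ G_(i+1)`, where the `B_k` are the expanded truncated random unitaries. By
cyclicity of the trace (`trace_hybrid_succ`) the honest messages satisfy every consistency relation
exactly for the exact inverse gates. They lead from `tr A` to the quantity the verifier computes
alone at the end. If `C` is off by `gap n`, the first check forces a large trace error on the
prover, while the last one leaves room only for a tiny error.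

A prover can therefore succeed only if the error shrinks drastically in some round. Write `E` for
the deviation from the honest message times the inverse gate. It depends on earlier coins only
(`deviation_update`), so the round's unitary is independent of `E`. Unless the coins are `Lucky`,
`|tr(E u)|` is at least `qubitLoss T ^ 3` times the largest entry of `E`; then `error_propagation`
shows that the error loses at most a factor of order `chi T`, up to the tolerance. As `gap n` is `4
* chi T ^ T` tolerances, `T` such losses cannot absorb it: acceptance implies a lucky round
(`exists_lucky_of_accepts`).

Luck has density at most `1 / (3 T)` per round. The trace is linear in each single-qubit unitary,
which reduces the matter to forms `α e^{it} + β e^{-it}` in one angle. Such a form is small only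
near a pair of antipodal points (`abs_sin_sub_lt_of_norm_lt`), hence at few grid angles. Every entry
of `E` is reached through two angles per qubit, and six exceptions of density `1 / (18 T)` add up to
`1 / (3 T)`. A union bound over rounds gives `1/3`, and averaging over the seed covers randomized
provers. -/

noncomputable section

namespace TopRowProtocol

/-! ### Events of small density in a finite type -/

open Classical in
/-- The event `P` has density at most `p` in the finite type `α`. -/
def DensityLE {α : Type*} [Fintype α] (P : α → Prop) (p : ℝ) : Prop :=
  ((Finset.univ.filter P).card : ℝ) ≤ p * Fintype.card α

section Density

variable {α β : Type*} [Fintype α] [Fintype β]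

theorem DensityLE.mono {P Q : α → Prop} {p q : ℝ} (h : DensityLE Q p) (hPQ : ∀ x, P x → Q x)
    (hpq : p ≤ q) : DensityLE P q := by
  classical
  unfold DensityLE at *
  have h1 : (Finset.univ.filter P).card ≤ (Finset.univ.filter Q).card :=
    Finset.card_le_card (Finset.monotone_filter_right _ (fun x _ => hPQ x))
  have h2 : ((Finset.univ.filter P).card : ℝ) ≤ (Finset.univ.filter Q).card := by exact_mod_cast h1
  have h3 : p * Fintype.card α ≤ q * Fintype.card α := by gcongr
  exact (h2.trans (by convert h)).trans h3

theorem DensityLE.or {P Q : α → Prop} {p q : ℝ} (hP : DensityLE P p) (hQ : DensityLE Q q) :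
    DensityLE (fun x => P x ∨ Q x) (p + q) := by
  classical
  unfold DensityLE at *
  have h1 : (Finset.univ.filter fun x => P x ∨ Q x).card
      ≤ (Finset.univ.filter P).card + (Finset.univ.filter Q).card := by
    rw [Finset.filter_or]
    exact Finset.card_union_le _ _
  have h2 : ((Finset.univ.filter fun x => P x ∨ Q x).card : ℝ)
      ≤ (Finset.univ.filter P).card + (Finset.univ.filter Q).card := by exact_mod_cast h1
  have h3 := h2.trans (add_le_add hP hQ)
  rw [← add_mul] at h3
  exact le_of_eq_of_le (by congr!) h3

theorem DensityLE.exists {ι : Type*} [Fintype ι] {P : ι → α → Prop} {p : ℝ}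
    (h : ∀ i, DensityLE (P i) p) : DensityLE (fun x => ∃ i, P i x) (Fintype.card ι * p) := by
  classical
  unfold DensityLE at *
  have h1 : (Finset.univ.filter fun x => ∃ i, P i x).card
      ≤ ∑ i, (Finset.univ.filter (P i)).card := by
    refine (Finset.card_le_card ?_).trans Finset.card_biUnion_le
    intro x
    simp
  have h2 : ((Finset.univ.filter fun x => ∃ i, P i x).card : ℝ)
      ≤ ∑ i, ((Finset.univ.filter (P i)).card : ℝ) := by exact_mod_cast h1
  have h3 : ∑ i, ((Finset.univ.filter (P i)).card : ℝ) ≤ ∑ _i : ι, p * Fintype.card α :=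
    Finset.sum_le_sum fun i _ => by convert h i
  rw [Finset.sum_const, Finset.card_univ, nsmul_eq_mul, ← mul_assoc] at h3
  exact le_of_eq_of_le (by congr!) (h2.trans h3)

/-- Counting fibre by fibre: a bound that holds conditionally on every value of the second
coordinate holds overall. -/
theorem DensityLE.of_equiv_prod {γ : Type*} [Fintype γ] (e : γ ≃ α × β) {P : γ → Prop} {p : ℝ}
    (h : ∀ b, DensityLE (fun a => P (e.symm (a, b))) p) : DensityLE P p := by
  classical
  unfold DensityLE at *
  have h1 : (Finset.univ.filter P).card
      = ∑ b, (Finset.univ.filter fun a => P (e.symm (a, b))).card := by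
    simp only [Finset.card_filter]
    rw [← Fintype.sum_prod_type_right (f := fun x => if P (e.symm x) then 1 else 0)]
    exact (Equiv.sum_comp e.symm (fun c => if P c then 1 else 0)).symm
  have h3 : ∑ b, ((Finset.univ.filter fun a => P (e.symm (a, b))).card : ℝ)
      ≤ ∑ _b : β, p * Fintype.card α :=
    Finset.sum_le_sum fun i _ => by convert h i
  rw [Finset.sum_const, Finset.card_univ, nsmul_eq_mul] at h3
  have h4 : ((Finset.univ.filter P).card : ℝ) ≤ p * Fintype.card γ := by
    rw [h1, Fintype.card_congr e, Fintype.card_prod]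
    push_cast
    linarith
  convert h4

theorem DensityLE.prod_left {P : α × β → Prop} {p : ℝ}
    (h : ∀ b, DensityLE (fun a => P (a, b)) p) : DensityLE P p :=
  DensityLE.of_equiv_prod (Equiv.refl _) h

theorem DensityLE.prod_right {P : α × β → Prop} {p : ℝ}
    (h : ∀ a, DensityLE (fun b => P (a, b)) p) : DensityLE P p :=
  DensityLE.of_equiv_prod (Equiv.prodComm _ _) h

/-- This is the form in which independence enters: the bad event for the fresh coordinate may depend
on all the others, provided its density is bounded uniformly. -/
theorem DensityLE.pi {ι : Type*} [Fintype ι] [DecidableEq ι] (i : ι) {P : (ι → α) → Prop} {p : ℝ}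
    (h : ∀ c, DensityLE (fun a => P (Function.update c i a)) p) : DensityLE P p := by
  rcases isEmpty_or_nonempty α with hα | ⟨⟨a₀⟩⟩
  · have : IsEmpty (ι → α) := ⟨fun f => hα.elim (f i)⟩
    simp [DensityLE]
  refine DensityLE.of_equiv_prod (Equiv.funSplitAt i α) fun f => ?_
  refine (h ((Equiv.funSplitAt i α).symm (a₀, f))).mono (fun a ha => ?_) le_rfl
  convert ha using 1
  ext j
  by_cases hj : j = i
  · subst hj; simp
  · simp [hj]

end Density

/-! ### Anticoncentration of trigonometric forms on the grid -/

/-- Cut the circle into four quarters. Within one quarter Jordan's inequality `2x/π ≤ sin x` turns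
the hypothesis into closeness of the angles, so `S` meets it in a short run of indices. The summand
4 is one endpoint per quarter. -/
theorem card_le_of_abs_sin_sub_lt {ξ ε : ℝ} (hξ : 0 < ξ) (hε : 0 ≤ ε) (S : Finset ℕ)
    (hS : ∀ k ∈ S, k * ξ < 2 * Real.pi)
    (h : ∀ k ∈ S, ∀ l ∈ S, |Real.sin (k * ξ - l * ξ)| < ε) :
    (S.card : ℝ) ≤ 2 * Real.pi / ξ * ε + 4 := by
  have hπ := Real.pi_pos
  set B : ℕ → ℕ := fun k => ⌊k * ξ / (Real.pi / 2)⌋₊ with hB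
  have hmaps : ∀ k ∈ S, B k ∈ Finset.range 4 := by
    intro k hk
    rw [Finset.mem_range, hB]
    simp only
    rw [Nat.floor_lt (by positivity), div_lt_iff₀ (by positivity)]
    have := hS k hk
    push_cast
    linarith
  have hblock : ∀ j, ((S.filter fun k => B k = j).card : ℝ) ≤ Real.pi * ε / (2 * ξ) + 1 := by
    intro j
    rcases (S.filter fun k => B k = j).eq_empty_or_nonempty with he | hne
    · rw [he]; simp; positivity
    set k₀ := (S.filter fun k => B k = j).min' hne with hk₀
    have hk₀m := Finset.mem_filter.1 ((S.filter fun k => B k = j).min'_mem hne)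
    rw [← hk₀] at hk₀m
    have hsub : (S.filter fun k => B k = j) ⊆ Finset.Icc k₀ (k₀ + ⌊Real.pi * ε / (2 * ξ)⌋₊) := by
      intro k hk
      have hle : k₀ ≤ k := Finset.min'_le _ _ hk
      rw [Finset.mem_filter] at hk
      obtain ⟨d, rfl⟩ := Nat.exists_eq_add_of_le hle
      rw [Finset.mem_Icc]
      refine ⟨hle, Nat.add_le_add_left (Nat.le_floor ?_) _⟩
      have hsin := h _ hk.1 _ hk₀m.1
      have e1 : ((k₀ + d : ℕ) : ℝ) * ξ - k₀ * ξ = d * ξ := by push_cast; ring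
      rw [e1] at hsin
      have hd : (d : ℝ) * ξ ≤ Real.pi / 2 := by
        have h1 : ((k₀ + d : ℕ) : ℝ) * ξ / (Real.pi / 2) < j + 1 := by
          rw [← hk.2]; exact Nat.lt_floor_add_one _
        have h2 : (j : ℝ) ≤ (k₀ : ℝ) * ξ / (Real.pi / 2) := by
          rw [← hk₀m.2]; exact Nat.floor_le (by positivity)
        rw [div_lt_iff₀ (by positivity)] at h1
        rw [le_div_iff₀ (by positivity)] at h2
        push_cast at h1
        nlinarith
      have h3 := Real.mul_le_sin (by positivity : 0 ≤ (d : ℝ) * ξ) hd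
      have h4 : 2 / Real.pi * (d * ξ) < ε := h3.trans_lt ((le_abs_self _).trans_lt hsin)
      rw [div_mul_eq_mul_div, div_lt_iff₀ hπ] at h4
      rw [le_div_iff₀ (by positivity)]
      linarith
    have hc := Finset.card_le_card hsub
    rw [Nat.card_Icc] at hc
    have hc' : (S.filter fun k => B k = j).card ≤ ⌊Real.pi * ε / (2 * ξ)⌋₊ + 1 := by omega
    calc ((S.filter fun k => B k = j).card : ℝ) ≤ (⌊Real.pi * ε / (2 * ξ)⌋₊ : ℝ) + 1 := by
          exact_mod_cast hc'
      _ ≤ _ := by gcongr; exact Nat.floor_le (by positivity)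
  rw [Finset.card_eq_sum_card_fiberwise hmaps]
  push_cast
  refine (Finset.sum_le_sum fun j _ => hblock j).trans ?_
  rw [Finset.sum_const, Finset.card_range, nsmul_eq_mul]
  apply le_of_eq
  field_simp
  ring

theorem abs_sin_sub_lt_of_norm_lt {α β : ℂ} {ε s t : ℝ}
    (hs : ‖α * Complex.exp (Complex.I * s) + β * Complex.exp (-(Complex.I * s))‖ < ε * ‖α‖)
    (ht : ‖α * Complex.exp (Complex.I * t) + β * Complex.exp (-(Complex.I * t))‖ < ε * ‖α‖) :
    |Real.sin (s - t)| < ε := by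
  have hα : 0 < ‖α‖ := by
    rcases (norm_nonneg α).eq_or_lt with h | h
    · rw [← h, mul_zero] at hs; exact absurd hs (not_lt.2 (norm_nonneg _))
    · exact h
  have hn : ∀ x : ℝ, ‖Complex.exp (Complex.I * x)‖ = 1 := fun x => by
    rw [mul_comm]; exact Complex.norm_exp_ofReal_mul_I x
  -- Eliminate `β`: multiplying the form at `s` by `e^{-it}` and the form at `t` by `e^{-is}` gives
  -- both the same `β` term.
  have key : α * (2 * Complex.I * Complex.sin ((s : ℂ) - t))
      = (α * Complex.exp (Complex.I * s) + β * Complex.exp (-(Complex.I * s)))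
          * Complex.exp (Complex.I * ((-t : ℝ) : ℂ))
        - (α * Complex.exp (Complex.I * t) + β * Complex.exp (-(Complex.I * t)))
          * Complex.exp (Complex.I * ((-s : ℝ) : ℂ)) := by
    rw [Complex.sin]
    have e1 : Complex.exp ((↑s - ↑t) * Complex.I)
        = Complex.exp (Complex.I * s) * Complex.exp (Complex.I * ((-t : ℝ) : ℂ)) := by
      rw [← Complex.exp_add]; congr 1; push_cast; ring
    have e2 : Complex.exp (-(↑s - ↑t) * Complex.I)
        = Complex.exp (Complex.I * t) * Complex.exp (Complex.I * ((-s : ℝ) : ℂ)) := by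
      rw [← Complex.exp_add]; congr 1; push_cast; ring
    have e3 : Complex.exp (-(Complex.I * s)) * Complex.exp (Complex.I * ((-t : ℝ) : ℂ))
        = Complex.exp (-(Complex.I * t)) * Complex.exp (Complex.I * ((-s : ℝ) : ℂ)) := by
      rw [← Complex.exp_add, ← Complex.exp_add]; congr 1; push_cast; ring
    rw [e1, e2]
    linear_combination β * (-e3) - (α * Complex.exp (Complex.I * s) *
      Complex.exp (Complex.I * ((-t : ℝ) : ℂ)) - α * Complex.exp (Complex.I * t) *
      Complex.exp (Complex.I * ((-s : ℝ) : ℂ))) * Complex.I_sq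
  have h1 := congrArg norm key
  rw [norm_mul, norm_mul, norm_mul, Complex.norm_I, ← Complex.ofReal_sub, ← Complex.ofReal_sin,
    Complex.norm_real, Real.norm_eq_abs] at h1
  have h2 := norm_sub_le
    ((α * Complex.exp (Complex.I * s) + β * Complex.exp (-(Complex.I * s)))
          * Complex.exp (Complex.I * ((-t : ℝ) : ℂ)))
    ((α * Complex.exp (Complex.I * t) + β * Complex.exp (-(Complex.I * t)))
          * Complex.exp (Complex.I * ((-s : ℝ) : ℂ)))
  rw [← h1, norm_mul, norm_mul, hn, hn] at h2
  norm_num at h2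
  by_contra hcon
  push Not at hcon
  nlinarith [mul_le_mul_of_nonneg_left hcon hα.le]

/-! ### Size estimates for the accuracy parameters -/

variable {n T : ℕ}

theorem one_le_cast (hT : 1 ≤ T) : (1 : ℝ) ≤ T := by exact_mod_cast hT

theorem gap_pos (n : ℕ) : 0 < gap n := by unfold gap; positivity

theorem gap_le (n : ℕ) : gap n ≤ 1 / 10 := by
  unfold gap
  have : (1 : ℝ) ≤ 2 ^ n := one_le_pow₀ (by norm_num)
  rw [div_le_div_iff₀ (by positivity) (by norm_num)]
  linarith

theorem chi_ge (hT : 1 ≤ T) : 60 ^ 12 * (T : ℝ) ≤ chi T := by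
  unfold chi
  gcongr
  exact le_self_pow₀ (one_le_cast hT) (by norm_num)

theorem one_le_chi (hT : 1 ≤ T) : 1 ≤ chi T := by
  have h1 := chi_ge hT
  have h2 := one_le_cast hT
  have h3 : (1 : ℝ) ≤ 60 ^ 12 := by norm_num
  nlinarith

theorem chi_pos (hT : 1 ≤ T) : 0 < chi T := zero_lt_one.trans_le (one_le_chi hT)

theorem tol_pos (hT : 1 ≤ T) : 0 < tol n T := by
  have := chi_pos hT
  have := gap_pos n
  unfold tol
  positivity

theorem gap_eq (hT : 1 ≤ T) : gap n = 4 * chi T ^ T * tol n T := by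
  have := chi_pos hT
  unfold tol
  field_simp

theorem tol_mul_chi_le (hT : 1 ≤ T) : 40 * (tol n T * chi T) ≤ 1 := by
  have h1 := gap_le n
  rw [gap_eq hT] at h1
  have h2 : chi T ≤ chi T ^ T := le_self_pow₀ (one_le_chi hT) (by omega)
  have := tol_pos (n := n) hT
  nlinarith

theorem prec_pos (hT : 1 ≤ T) : 0 < prec n T := by
  have := tol_pos (n := n) hT
  have := one_le_cast hT
  unfold prec
  positivity

theorem prec_mul_le (hT : 1 ≤ T) : 2 ^ (2 * n + 11) * prec n T ≤ tol n T := by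
  have h1 := one_le_cast hT
  have h2 := tol_pos (n := n) hT
  unfold prec
  rw [mul_div_assoc', div_le_iff₀ (by positivity)]
  nlinarith [mul_pos (pow_pos (by norm_num : (0 : ℝ) < 2) (2 * n + 11)) h2]

theorem prec_le_tol (hT : 1 ≤ T) : 2 ^ 11 * prec n T ≤ tol n T := by
  refine le_trans ?_ (prec_mul_le hT)
  have := prec_pos (n := n) hT
  gcongr
  · norm_num
  · omega

theorem prec_mul_chi_le (hT : 1 ≤ T) : 2 ^ 16 * (prec n T * chi T) ≤ 1 := by
  have h1 := tol_mul_chi_le (n := n) hT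
  have h2 := prec_le_tol (n := n) hT
  have h3 := chi_pos hT
  have := mul_le_mul_of_nonneg_right h2 h3.le
  have := mul_pos (prec_pos (n := n) hT) h3
  norm_num at *
  linarith

theorem prec_le_one (hT : 1 ≤ T) : prec n T ≤ 1 := by
  have h1 := prec_mul_chi_le (n := n) hT
  have h2 := one_le_chi hT
  have h3 := prec_pos (n := n) hT
  nlinarith

/-- The relative loss allowed for a single angle. -/
def angleLoss (T : ℕ) : ℝ := 1 / (36 * T)

theorem angleLoss_pos (hT : 1 ≤ T) : 0 < angleLoss T := by
  have := one_le_cast hT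
  unfold angleLoss
  positivity

theorem densityLE_grid_of_abs_sin_lt (hT : 1 ≤ T) (P : Fin (gridSize n T) → Prop)
    (h : ∀ k l, P k → P l → |Real.sin (gridAngle k - gridAngle l)| < angleLoss T) :
    DensityLE P (1 / (18 * T)) := by
  classical
  have hT' := one_le_cast hT
  have hξ := prec_pos (n := n) hT
  have hlt : ∀ k : Fin (gridSize n T), ((k : ℕ) : ℝ) * prec n T < 2 * Real.pi := by
    intro k
    have := Nat.lt_ceil.1 k.2
    rwa [lt_div_iff₀ hξ] at this
  have hN : 2 * Real.pi / prec n T ≤ gridSize n T := Nat.le_ceil _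
  have hc := card_le_of_abs_sin_sub_lt hξ (angleLoss_pos hT).le
    ((Finset.univ.filter P).map Fin.valEmbedding)
    (by
      intro k hk
      obtain ⟨k', _, rfl⟩ := Finset.mem_map.1 hk
      exact hlt k')
    (by
      intro k hk l hl
      obtain ⟨k', hk', rfl⟩ := Finset.mem_map.1 hk
      obtain ⟨l', hl', rfl⟩ := Finset.mem_map.1 hl
      exact h k' l' (Finset.mem_filter.1 hk').2 (Finset.mem_filter.1 hl').2)
  rw [Finset.card_map] at hc
  -- The grid is so fine that the additive 4 is at most the main term `gridSize n T / (36 T)`; the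
  -- two together give `1 / (18 T)`.
  have hbig : 144 * (T : ℝ) ≤ gridSize n T := by
    refine le_trans ?_ hN
    rw [le_div_iff₀ hξ]
    have h1 := prec_mul_chi_le (n := n) hT
    have h2 := mul_le_mul_of_nonneg_left (chi_ge hT) hξ.le
    have h3 := Real.pi_gt_three
    norm_num at *
    have : 0 < prec n T * T := by positivity
    nlinarith
  have hfin : (((Finset.univ.filter P)).card : ℝ) ≤ 1 / (18 * T) * Fintype.card (Fin (gridSize n T)) := by
    rw [Fintype.card_fin]
    have h4 : 2 * Real.pi / prec n T * angleLoss T ≤ gridSize n T * angleLoss T :=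
      mul_le_mul_of_nonneg_right hN (angleLoss_pos hT).le
    have h5 : (4 : ℝ) ≤ gridSize n T * angleLoss T := by
      unfold angleLoss
      rw [mul_one_div, le_div_iff₀ (by positivity)]
      linarith
    have h6 : 1 / (18 * (T : ℝ)) * gridSize n T = 2 * (gridSize n T * angleLoss T) := by
      unfold angleLoss
      field_simp
      ring
    linarith
  unfold DensityLE
  convert hfin

theorem densityLE_exp_left (hT : 1 ≤ T) (α β : ℂ) :
    DensityLE (fun k : Fin (gridSize n T) =>
      ‖α * Complex.exp (Complex.I * gridAngle k) + β * Complex.exp (-(Complex.I * gridAngle k))‖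
        < angleLoss T * ‖α‖) (1 / (18 * T)) :=
  densityLE_grid_of_abs_sin_lt hT _ fun _ _ hk hl => abs_sin_sub_lt_of_norm_lt hk hl

/-- Replacing the angle by its negative exchanges the two coefficients. -/
theorem densityLE_exp_right (hT : 1 ≤ T) (α β : ℂ) :
    DensityLE (fun k : Fin (gridSize n T) =>
      ‖α * Complex.exp (Complex.I * gridAngle k) + β * Complex.exp (-(Complex.I * gridAngle k))‖
        < angleLoss T * ‖β‖) (1 / (18 * T)) := by
  refine densityLE_grid_of_abs_sin_lt hT _ fun k l hk hl => ?_
  have := @abs_sin_sub_lt_of_norm_lt β α (angleLoss T) (-gridAngle k) (-gridAngle l)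
    (by simpa [add_comm] using hk) (by simpa [add_comm] using hl)
  rwa [show -(gridAngle k) - -(gridAngle l) = -(gridAngle k - gridAngle l) by ring, Real.sin_neg,
    abs_neg] at this

theorem cos_add_sin_eq_exp (a b : ℂ) (t : ℝ) :
    (Real.cos t : ℂ) * a + (Real.sin t : ℂ) * b
      = (a - Complex.I * b) / 2 * Complex.exp (Complex.I * t)
        + (a + Complex.I * b) / 2 * Complex.exp (-(Complex.I * t)) := by
  have e1 : Complex.exp (Complex.I * t) = Complex.cos t + Complex.sin t * Complex.I := by
    rw [mul_comm, Complex.exp_mul_I]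
  have e2 : Complex.exp (-(Complex.I * t)) = Complex.cos t - Complex.sin t * Complex.I := by
    rw [show -(Complex.I * t) = (-t : ℂ) * Complex.I by ring, Complex.exp_mul_I, Complex.cos_neg,
      Complex.sin_neg]
    ring
  rw [e1, e2, Complex.ofReal_cos, Complex.ofReal_sin]
  linear_combination (Complex.sin t * b) * Complex.I_sq

theorem densityLE_cos_sin (hT : 1 ≤ T) (a b : ℂ) (m : ℝ) (hm : m ≤ ‖a‖ ∨ m ≤ ‖b‖) :
    DensityLE (fun k : Fin (gridSize n T) =>
      ‖(Real.cos (gridAngle k) : ℂ) * a + (Real.sin (gridAngle k) : ℂ) * b‖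
        < angleLoss T / 2 * m) (1 / (18 * T)) := by
  have hε := angleLoss_pos hT
  -- The sum of the two exponential coefficients is `a` and their difference is `-(I * b)`, so the
  -- larger has norm at least `m / 2`.
  have hsum : 2 * m ≤ 2 * (‖(a - Complex.I * b) / 2‖ + ‖(a + Complex.I * b) / 2‖) := by
    rcases hm with hm | hm
    · have := norm_add_le ((a - Complex.I * b) / 2) ((a + Complex.I * b) / 2)
      rw [show (a - Complex.I * b) / 2 + (a + Complex.I * b) / 2 = a by ring] at this
      linarith
    · have := norm_sub_le ((a - Complex.I * b) / 2) ((a + Complex.I * b) / 2)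
      rw [show (a - Complex.I * b) / 2 - (a + Complex.I * b) / 2 = -(Complex.I * b) by ring,
        norm_neg, norm_mul, Complex.norm_I, one_mul] at this
      linarith
  simp_rw [cos_add_sin_eq_exp]
  rcases le_total ‖(a - Complex.I * b) / 2‖ ‖(a + Complex.I * b) / 2‖ with h | h
  · refine (densityLE_exp_right hT _ _).mono (fun k hk => hk.trans_le ?_) le_rfl
    nlinarith
  · refine (densityLE_exp_left hT _ _).mono (fun k hk => hk.trans_le ?_) le_rfl
    nlinarith

/-! ### Anticoncentration for one qubit and for three qubits -/

theorem sum_mul_qubitUnitary (F : Fin 2 → Fin 2 → ℂ) (θ φ₁ φ₂ : ℝ) :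
    ∑ x, ∑ y, F x y * qubitUnitary θ φ₁ φ₂ y x
      = (Real.cos θ : ℂ) * (F 0 0 * Complex.exp (Complex.I * φ₁)
            + F 1 1 * Complex.exp (-(Complex.I * φ₁)))
        + (Real.sin θ : ℂ) * (F 1 0 * Complex.exp (Complex.I * φ₂)
            + (-F 0 1) * Complex.exp (-(Complex.I * φ₂))) := by
  simp [Fin.sum_univ_two, qubitUnitary]
  ring

/-- The relative loss allowed for a single-qubit unitary. -/
def qubitLoss (T : ℕ) : ℝ := angleLoss T ^ 2 / 2

theorem qubitLoss_pos (hT : 1 ≤ T) : 0 < qubitLoss T := by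
  have := angleLoss_pos hT
  unfold qubitLoss
  positivity

/-- Diagonal entries of `F` occur in the coefficient of `cos θ`, off-diagonal ones in that of `sin
θ`. First `φ₁` or `φ₂` keeps the relevant coefficient large, at a loss `angleLoss T`; then `θ` keeps
the whole form large, at a loss `angleLoss T / 2`. -/
theorem densityLE_qubit (hT : 1 ≤ T) (F : Fin 2 → Fin 2 → ℂ) (a b : Fin 2) :
    DensityLE (fun q : QubitCoins n T =>
      ‖∑ x, ∑ y, F x y * sampledUnitary q y x‖ < qubitLoss T * ‖F a b‖) (1 / (9 * T)) := by
  have hε := angleLoss_pos hT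
  have hp : (1 : ℝ) / (18 * T) + 1 / (18 * T) ≤ 1 / (9 * T) := by
    have := one_le_cast hT
    apply le_of_eq
    field_simp
    norm_num
  set A : ℝ → ℂ := fun t => F 0 0 * Complex.exp (Complex.I * t)
            + F 1 1 * Complex.exp (-(Complex.I * t)) with hA
  set B : ℝ → ℂ := fun t => F 1 0 * Complex.exp (Complex.I * t)
            + (-F 0 1) * Complex.exp (-(Complex.I * t)) with hB
  have hE : ∀ q : QubitCoins n T, ∑ x, ∑ y, F x y * sampledUnitary q y x
      = (Real.cos (gridAngle q.1) : ℂ) * A (gridAngle q.2.1)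
        + (Real.sin (gridAngle q.1) : ℂ) * B (gridAngle q.2.2) := fun q =>
    sum_mul_qubitUnitary F _ _ _
  simp_rw [hE]
  -- `G` is the norm of the coefficient that carries the chosen entry. It does not involve `θ`, so
  -- `θ` can be treated as drawn after it.
  have main : ∀ (G : QubitCoins n T → ℝ) (m : ℝ),
      (∀ q, G q = ‖A (gridAngle q.2.1)‖ ∨ G q = ‖B (gridAngle q.2.2)‖) →
      (∀ q r, G (r, q.2) = G q) →
      DensityLE (fun q => G q < angleLoss T * m) (1 / (18 * T)) →
      DensityLE (fun q : QubitCoins n T => ‖(Real.cos (gridAngle q.1) : ℂ) * A (gridAngle q.2.1)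
        + (Real.sin (gridAngle q.1) : ℂ) * B (gridAngle q.2.2)‖ < qubitLoss T * m)
          (1 / (9 * T)) := by
    intro G m hG hG' h1
    have h2 : DensityLE (fun q : QubitCoins n T =>
        ‖(Real.cos (gridAngle q.1) : ℂ) * A (gridAngle q.2.1)
        + (Real.sin (gridAngle q.1) : ℂ) * B (gridAngle q.2.2)‖ < angleLoss T / 2 * G q)
          (1 / (18 * T)) := by
      refine DensityLE.prod_left fun r => ?_
      by_cases hne : Nonempty (Fin (gridSize n T))
      · obtain ⟨k₀⟩ := hne
        refine (densityLE_cos_sin hT (A (gridAngle r.1)) (B (gridAngle r.2)) (G (k₀, r)) ?_).mono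
          (fun k hk => ?_) le_rfl
        · rcases hG (k₀, r) with h | h
          · exact Or.inl h.le
          · exact Or.inr h.le
        · rw [← hG' (k, r) k₀] at hk
          exact hk
      · rw [not_nonempty_iff] at hne
        simp [DensityLE]
    refine (h1.or h2).mono (fun q hq => ?_) hp
    by_contra hcon
    push Not at hcon
    have h3 := hq.trans_le' hcon.2
    unfold qubitLoss at h3
    nlinarith [hcon.1]
  have hdiag : ∀ m, DensityLE (fun k : Fin (gridSize n T) => ‖A (gridAngle k)‖ < angleLoss T * m)
      (1 / (18 * T)) → DensityLE (fun q : QubitCoins n T =>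
      ‖(Real.cos (gridAngle q.1) : ℂ) * A (gridAngle q.2.1)
        + (Real.sin (gridAngle q.1) : ℂ) * B (gridAngle q.2.2)‖ < qubitLoss T * m)
          (1 / (9 * T)) := fun m h =>
    main (fun q => ‖A (gridAngle q.2.1)‖) m (fun _ => Or.inl rfl) (fun _ _ => rfl)
      (DensityLE.prod_right fun _ => DensityLE.prod_left fun _ => h)
  have hoff : ∀ m, DensityLE (fun k : Fin (gridSize n T) => ‖B (gridAngle k)‖ < angleLoss T * m)
      (1 / (18 * T)) → DensityLE (fun q : QubitCoins n T =>
      ‖(Real.cos (gridAngle q.1) : ℂ) * A (gridAngle q.2.1)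
        + (Real.sin (gridAngle q.1) : ℂ) * B (gridAngle q.2.2)‖ < qubitLoss T * m)
          (1 / (9 * T)) := fun m h =>
    main (fun q => ‖B (gridAngle q.2.2)‖) m (fun _ => Or.inr rfl) (fun _ _ => rfl)
      (DensityLE.prod_right fun _ => DensityLE.prod_right fun _ => h)
  fin_cases a <;> fin_cases b
  · exact hdiag _ (densityLE_exp_left hT _ _)
  · refine hoff _ ?_
    have := densityLE_exp_right (n := n) hT (F 1 0) (-F 0 1)
    rwa [norm_neg] at this
  · exact hoff _ (densityLE_exp_left hT _ _)
  · exact hdiag _ (densityLE_exp_right hT _ _)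

theorem sum_fin_three_arrow {α M : Type*} [Fintype α] [AddCommMonoid M]
    (f : (Fin 3 → α) → M) : ∑ a, f a = ∑ x, ∑ y, ∑ z, f ![x, y, z] := by
  let e : (Fin 3 → α) ≃ α × α × α :=
    { toFun := fun a => (a 0, a 1, a 2)
      invFun := fun p => ![p.1, p.2.1, p.2.2]
      left_inv := fun a => by ext i; fin_cases i <;> rfl
      right_inv := fun p => rfl }
  rw [← Equiv.sum_comp e.symm, Fintype.sum_prod_type]
  simp_rw [Fintype.sum_prod_type]
  rfl

/-- The exact three-qubit unitary represented by the choices of a round. -/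
def exactOp (r : RoundCoins n T) : Op3 := tensor3 fun j => sampledUnitary (r j)

theorem trace_mul_exactOp (E : Op3) (r : RoundCoins n T) :
    (E * exactOp r).trace = ∑ x₂, ∑ y₂, (∑ x₁, ∑ y₁, (∑ x₀, ∑ y₀, E ![x₀, x₁, x₂] ![y₀, y₁, y₂]
      * sampledUnitary (r 0) y₀ x₀) * sampledUnitary (r 1) y₁ x₁) * sampledUnitary (r 2) y₂ x₂ := by
  simp only [Matrix.trace, Matrix.diag, Matrix.mul_apply, exactOp, tensor3, Fin.prod_univ_three,
    sum_fin_three_arrow, Fin.sum_univ_two, Matrix.cons_val]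
  ring

/-- Contract `E` with one qubit's unitary at a time. Each contraction keeps one entry of the
resulting smaller tensor comparable to the entry tracked so far, except with density `1 / (9 T)`. -/
theorem densityLE_round (hT : 1 ≤ T) (E : Op3) (a b : Fin 3 → Fin 2) :
    DensityLE (fun r : RoundCoins n T =>
      ‖(E * exactOp r).trace‖ < qubitLoss T ^ 3 * ‖E a b‖) (1 / (3 * T)) := by
  have hδ := qubitLoss_pos hT
  set F₀ : Fin 2 → Fin 2 → Fin 2 → Fin 2 → Fin 2 → Fin 2 → ℂ := fun x₂ y₂ x₁ y₁ x₀ y₀ =>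
    E ![x₀, x₁, x₂] ![y₀, y₁, y₂] with hF₀
  set F₁ : QubitCoins n T → Fin 2 → Fin 2 → Fin 2 → Fin 2 → ℂ := fun q x₂ y₂ x₁ y₁ =>
    ∑ x, ∑ y, F₀ x₂ y₂ x₁ y₁ x y * sampledUnitary q y x with hF₁
  set F₂ : QubitCoins n T → QubitCoins n T → Fin 2 → Fin 2 → ℂ := fun q q' x₂ y₂ =>
    ∑ x, ∑ y, F₁ q x₂ y₂ x y * sampledUnitary q' y x with hF₂
  have hE : ∀ r : RoundCoins n T, (E * exactOp r).trace
      = ∑ x, ∑ y, F₂ (r 0) (r 1) x y * sampledUnitary (r 2) y x := trace_mul_exactOp E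
  have hab : E a b = F₀ (a 2) (b 2) (a 1) (b 1) (a 0) (b 0) := by
    simp only [hF₀]
    congr 1 <;> (ext i; fin_cases i <;> rfl)
  have h0 : DensityLE (fun r : RoundCoins n T => ‖F₁ (r 0) (a 2) (b 2) (a 1) (b 1)‖
      < qubitLoss T * ‖E a b‖) (1 / (9 * T)) := by
    refine DensityLE.pi 0 fun c => ?_
    simp only [Function.update_self, hab]
    exact densityLE_qubit hT _ _ _
  have h1 : DensityLE (fun r : RoundCoins n T => ‖F₂ (r 0) (r 1) (a 2) (b 2)‖
      < qubitLoss T * ‖F₁ (r 0) (a 2) (b 2) (a 1) (b 1)‖) (1 / (9 * T)) := by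
    refine DensityLE.pi 1 fun c => ?_
    simp only [Function.update_self, Function.update_of_ne (show (0 : Fin 3) ≠ 1 by decide)]
    exact densityLE_qubit hT _ _ _
  have h2 : DensityLE (fun r : RoundCoins n T => ‖(E * exactOp r).trace‖
      < qubitLoss T * ‖F₂ (r 0) (r 1) (a 2) (b 2)‖) (1 / (9 * T)) := by
    simp_rw [hE]
    refine DensityLE.pi 2 fun c => ?_
    simp only [Function.update_self, Function.update_of_ne (show (0 : Fin 3) ≠ 2 by decide),
      Function.update_of_ne (show (1 : Fin 3) ≠ 2 by decide)]
    exact densityLE_qubit hT _ _ _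
  refine ((h0.or h1).or h2).mono (fun r hr => ?_) ?_
  · by_contra hcon
    push Not at hcon
    obtain ⟨⟨g0, g1⟩, g2⟩ := hcon
    refine absurd hr (not_lt.2 ?_)
    calc qubitLoss T ^ 3 * ‖E a b‖ = qubitLoss T * (qubitLoss T * (qubitLoss T * ‖E a b‖)) := by
          ring
      _ ≤ qubitLoss T * (qubitLoss T * ‖F₁ (r 0) (a 2) (b 2) (a 1) (b 1)‖) := by gcongr
      _ ≤ qubitLoss T * ‖F₂ (r 0) (r 1) (a 2) (b 2)‖ := by gcongr
      _ ≤ _ := g2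
  · have := one_le_cast hT
    apply le_of_eq
    field_simp
    norm_num


variable {g : Fin T → LocalGate n}

/-! ### Expansion to `n` qubits and partial traces -/

theorem expand_one (s : Fin 3 ↪ Fin n) : expand s 1 = 1 := by
  ext x y
  simp only [expand, Matrix.one_apply]
  by_cases h : x = y
  · subst h; simp
  · rw [if_neg h]
    split_ifs with h1 h2
    · exfalso
      apply h
      ext q
      by_cases hq : ∃ j, s j = q
      · obtain ⟨j, rfl⟩ := hq
        exact congrArg _ (congrFun h2 j)
      · exact congrArg _ (h1 q fun j hj => hq ⟨j, hj⟩)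
    · rfl
    · rfl

theorem expand_mul (s : Fin 3 ↪ Fin n) (b c : Op3) :
    expand s b * expand s c = expand s (b * c) := by
  ext x z
  simp only [expand, Matrix.mul_apply]
  split_ifs with h
  · symm
    -- Only intermediate states that agree with `x` off the three qubits contribute; they are
    -- parametrized by their values on these qubits.
    refine Finset.sum_of_injOn (fun a => Function.extend s a x) ?_ ?_ ?_ ?_
    · intro a _ a' _ haa
      ext j
      have := congrFun haa (s j)
      simp only [s.injective.extend_apply] at this
      rw [this]
    · simp
    · intro y _ hy
      rw [if_neg, zero_mul]
      intro hxy
      apply hy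
      refine ⟨fun j => y (s j), by simp, ?_⟩
      ext q
      by_cases hq : ∃ j, s j = q
      · obtain ⟨j, rfl⟩ := hq
        simp [s.injective.extend_apply]
      · simp only [Function.extend_apply' _ _ _ hq]
        rw [hxy q fun j hj => hq ⟨j, hj⟩]
    · intro a _
      have he : ∀ q, (∀ j, s j ≠ q) → Function.extend s a x q = x q := fun q hq =>
        Function.extend_apply' _ _ _ fun ⟨j, hj⟩ => hq j hj
      rw [if_pos fun q hq => (he q hq).symm, if_pos fun q hq => (he q hq).trans (h q hq)]
      simp only [s.injective.extend_apply]
  · refine Finset.sum_eq_zero fun y _ => ?_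
    split_ifs with h1 h2
    · exact absurd (fun q hq => (h1 q hq).trans (h2 q hq)) h
    all_goals simp

theorem star_expand (s : Fin 3 ↪ Fin n) (b : Op3) : star (expand s b) = expand s (star b) := by
  ext x y
  simp only [expand, Matrix.star_apply]
  simp_rw [eq_comm (a := y _)]
  split_ifs <;> simp

theorem expand_mem_unitaryGroup (s : Fin 3 ↪ Fin n) {b : Op3}
    (hb : b ∈ Matrix.unitaryGroup (Fin 3 → Fin 2) ℂ) :
    expand s b ∈ Matrix.unitaryGroup (Fin n → Fin 2) ℂ := by
  rw [Matrix.mem_unitaryGroup_iff] at hb ⊢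
  rw [star_expand, expand_mul, hb, expand_one]

/-- The trace of `A` over all qubits except `s 0, s 1, s 2`. -/
def ptrace (s : Fin 3 ↪ Fin n) (A : OpN n) : Op3 := fun a b =>
  ∑ x, ∑ y, if (fun j => x (s j)) = a ∧ (fun j => y (s j)) = b ∧ ∀ q, (∀ j, s j ≠ q) → y q = x q
    then A x y else 0

/-- The partial trace is adjoint to `expand`, so an 8 × 8 message carries all that a check involving
three qubits can see. -/
theorem trace_ptrace_mul (s : Fin 3 ↪ Fin n) (A : OpN n) (b : Op3) :
    (ptrace s A * b).trace = (A * expand s b).trace := by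
  simp only [Matrix.trace, Matrix.diag, Matrix.mul_apply, ptrace, expand]
  simp_rw [Finset.sum_mul]
  rw [Finset.sum_congr rfl fun a _ => Finset.sum_comm, Finset.sum_comm]
  refine Finset.sum_congr rfl fun x _ => ?_
  rw [Finset.sum_congr rfl fun a _ => Finset.sum_comm, Finset.sum_comm]
  refine Finset.sum_congr rfl fun y _ => ?_
  rw [Finset.sum_eq_single (fun j => x (s j)), Finset.sum_eq_single (fun j => y (s j))]
  · by_cases h : ∀ q, (∀ j, s j ≠ q) → y q = x q
    · rw [if_pos ⟨rfl, rfl, h⟩, if_pos h]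
    · rw [if_neg fun h' => h h'.2.2, if_neg h, zero_mul, mul_zero]
  · intro b' _ hb'
    rw [if_neg fun h' => hb' h'.2.1.symm, zero_mul]
  · simp
  · intro a' _ ha'
    refine Finset.sum_eq_zero fun b' _ => ?_
    rw [if_neg fun h' => ha' h'.1.symm, zero_mul]
  · simp

theorem trace_ptrace (s : Fin 3 ↪ Fin n) (A : OpN n) : (ptrace s A).trace = A.trace := by
  have := trace_ptrace_mul s A 1
  rwa [expand_one, mul_one, mul_one] at this

theorem norm_ptrace_le (s : Fin 3 ↪ Fin n) (A : OpN n) (a b : Fin 3 → Fin 2) :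
    ‖ptrace s A a b‖ ≤ ∑ x, ∑ y, ‖A x y‖ := by
  refine (norm_sum_le _ _).trans (Finset.sum_le_sum fun x _ => ?_)
  refine (norm_sum_le _ _).trans (Finset.sum_le_sum fun y _ => ?_)
  split_ifs
  · exact le_rfl
  · simp

theorem norm_ptrace_zeroProj_mul_le (s : Fin 3 ↪ Fin n) {G : OpN n}
    (hG : G ∈ Matrix.unitaryGroup (Fin n → Fin 2) ℂ) (a b : Fin 3 → Fin 2) :
    ‖ptrace s (zeroProj n * G) a b‖ ≤ 2 ^ n := by
  refine (norm_ptrace_le s _ a b).trans ?_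
  rw [Finset.sum_eq_single 0]
  · calc ∑ y, ‖(zeroProj n * G) 0 y‖ ≤ ∑ _y : Fin n → Fin 2, (1 : ℝ) := by
          refine Finset.sum_le_sum fun y _ => ?_
          rw [zeroProj, Matrix.single_mul_apply_same, one_mul]
          exact entry_norm_bound_of_unitary hG _ _
      _ = 2 ^ n := by simp
  · intro x _ hx
    refine Finset.sum_eq_zero fun y _ => ?_
    rw [zeroProj, Matrix.single_mul_apply_of_ne _ _ _ _ _ hx, norm_zero]
  · simp

/-! ### Hybrid products -/

/-- The product `B_i ⋯ B_1 |0ⁿ⟩⟨0ⁿ| G_T ⋯ G_(i+1)`. -/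
def hybrid (B G : Fin T → OpN n) (i : ℕ) : OpN n :=
  ((List.ofFn B).take i).reverse.prod * zeroProj n * ((List.ofFn G).drop i).reverse.prod

theorem hybrid_zero (B G : Fin T → OpN n) : hybrid B G 0 = zeroProj n * descProd G := by
  simp [hybrid, descProd]

theorem hybrid_last (B G : Fin T → OpN n) : hybrid B G T = descProd B * zeroProj n := by
  simp [hybrid, descProd, List.take_of_length_le, List.drop_of_length_le]

/-- `G i` is the rightmost factor of the hybrid. Multiplication by `H` replaces it by `B i`, which
cyclicity moves to the front. -/
theorem trace_hybrid_succ (B G : Fin T → OpN n) (i : Fin T) (H : OpN n) (hH : G i * H = B i) :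
    (hybrid B G i * H).trace = (hybrid B G (i + 1)).trace := by
  have hB : (List.ofFn B).take (i + 1) = (List.ofFn B).take i ++ [B i] := by
    rw [List.take_add_one]
    simp
  have hG : (List.ofFn G).drop i = G i :: (List.ofFn G).drop (i + 1) := by
    rw [List.drop_eq_getElem_cons (by simp)]
    simp
  unfold hybrid
  rw [hB, hG]
  simp only [List.reverse_append, List.reverse_cons, List.prod_append, List.reverse_nil,
    List.nil_append, List.prod_cons, List.prod_nil, mul_one, List.singleton_append]
  rw [Matrix.mul_assoc, Matrix.mul_assoc _ (G i), hH, ← Matrix.mul_assoc, Matrix.trace_mul_comm]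
  simp only [Matrix.mul_assoc]

theorem hybrid_congr {B B' : Fin T → OpN n} (G : Fin T → OpN n) (i : ℕ)
    (h : ∀ k : Fin T, (k : ℕ) < i → B k = B' k) : hybrid B G i = hybrid B' G i := by
  have : (List.ofFn B).take i = (List.ofFn B').take i := by
    refine List.ext_getElem (by simp) fun k hk hk' => ?_
    simp only [List.length_take, List.length_ofFn, lt_min_iff] at hk
    simp [h ⟨k, hk.2⟩ hk.1]
  rw [hybrid, hybrid, this]

theorem descProd_mem_unitaryGroup {G : Fin T → OpN n}
    (hG : ∀ i, G i ∈ Matrix.unitaryGroup (Fin n → Fin 2) ℂ) :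
    descProd G ∈ Matrix.unitaryGroup (Fin n → Fin 2) ℂ := by
  refine list_prod_mem fun x hx => ?_
  rw [List.mem_reverse, List.mem_ofFn] at hx
  obtain ⟨i, rfl⟩ := hx
  exact hG i

/-! ### Entrywise bounds -/

theorem norm_mul_apply_le {A B : Op3} {α β : ℝ} (hα : 0 ≤ α) (hA : ∀ a b, ‖A a b‖ ≤ α)
    (hB : ∀ a b, ‖B a b‖ ≤ β) (a b : Fin 3 → Fin 2) : ‖(A * B) a b‖ ≤ 8 * (α * β) := by
  rw [Matrix.mul_apply]
  calc ‖∑ c, A a c * B c b‖ ≤ ∑ _c : Fin 3 → Fin 2, α * β := by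
        refine (norm_sum_le _ _).trans (Finset.sum_le_sum fun c _ => ?_)
        rw [norm_mul]
        exact mul_le_mul (hA _ _) (hB _ _) (norm_nonneg _) hα
    _ = _ := by simp

theorem norm_trace_le {A : Op3} {α : ℝ} (hA : ∀ a b, ‖A a b‖ ≤ α) : ‖A.trace‖ ≤ 8 * α := by
  calc ‖∑ c, A c c‖ ≤ ∑ _c : Fin 3 → Fin 2, α :=
        (norm_sum_le _ _).trans (Finset.sum_le_sum fun c _ => hA _ _)
    _ = _ := by simp

theorem norm_trace_mul_le {A B : Op3} {α β : ℝ} (hα : 0 ≤ α) (hA : ∀ a b, ‖A a b‖ ≤ α)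
    (hB : ∀ a b, ‖B a b‖ ≤ β) : ‖(A * B).trace‖ ≤ 64 * (α * β) := by
  have := norm_trace_le (norm_mul_apply_le hα hA hB)
  linarith

theorem norm_sampledUnitary_le (q : QubitCoins n T) (x y : Fin 2) :
    ‖sampledUnitary q x y‖ ≤ 1 := by
  have hn : ∀ t : ℝ, ‖Complex.exp (Complex.I * t)‖ = 1 := fun t => by
    rw [mul_comm]; exact Complex.norm_exp_ofReal_mul_I t
  have hn' : ∀ t : ℝ, ‖Complex.exp (-(Complex.I * t))‖ = 1 := fun t => by
    have := hn (-t)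
    rwa [Complex.ofReal_neg, mul_neg] at this
  have hc : ∀ t : ℝ, ‖(Real.cos t : ℂ)‖ ≤ 1 := fun t => by
    rw [Complex.norm_real]; exact Real.abs_cos_le_one t
  have hs : ∀ t : ℝ, ‖(Real.sin t : ℂ)‖ ≤ 1 := fun t => by
    rw [Complex.norm_real]; exact Real.abs_sin_le_one t
  unfold sampledUnitary qubitUnitary
  fin_cases x <;> fin_cases y <;>
    simp only [Fin.zero_eta, Fin.mk_one, Matrix.of_apply, Matrix.cons_val, norm_mul, norm_neg, hn,
      hn', mul_one, hc, hs]

variable {trunc : QubitCoins n T → Matrix (Fin 2) (Fin 2) ℂ}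

theorem norm_roundOp_sub_exactOp_le (hT : 1 ≤ T)
    (htrunc : ∀ q, IsTruncation (prec n T) (trunc q) (sampledUnitary q))
    (r : RoundCoins n T) (a b : Fin 3 → Fin 2) :
    ‖roundOp trunc r a b - exactOp r a b‖ ≤ 7 * prec n T := by
  simp only [roundOp, exactOp, tensor3, Fin.prod_univ_three]
  have hξ := prec_pos (n := n) hT
  have hξ1 := prec_le_one (n := n) hT
  have h := fun j => htrunc (r j) (a j) (b j)
  have h1 := fun j => norm_sampledUnitary_le (r j) (a j) (b j)
  have h2 : ∀ j, ‖trunc (r j) (a j) (b j)‖ ≤ 2 := fun j => by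
    have := norm_add_le (trunc (r j) (a j) (b j) - sampledUnitary (r j) (a j) (b j))
      (sampledUnitary (r j) (a j) (b j))
    rw [sub_add_cancel] at this
    linarith [h j, h1 j]
  generalize hx : (fun j => trunc (r j) (a j) (b j)) = x at *
  generalize hy : (fun j => sampledUnitary (r j) (a j) (b j)) = y at *
  simp only [funext_iff] at hx hy
  simp only [hx, hy] at *
  -- Telescoping, with truncated entries bounded by 2 and exact ones by 1: `4 + 2 + 1 = 7`.
  have e : x 0 * x 1 * x 2 - y 0 * y 1 * y 2 = (x 0 - y 0) * (x 1 * x 2)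
      + y 0 * ((x 1 - y 1) * x 2) + y 0 * (y 1 * (x 2 - y 2)) := by ring
  rw [e]
  refine (norm_add₃_le).trans ?_
  simp only [norm_mul]
  have b1 : ‖x 0 - y 0‖ * (‖x 1‖ * ‖x 2‖) ≤ prec n T * (2 * 2) := by
    gcongr; exacts [h 0, h2 1, h2 2]
  have b2 : ‖y 0‖ * (‖x 1 - y 1‖ * ‖x 2‖) ≤ 1 * (prec n T * 2) := by
    gcongr; exacts [h1 0, h 1, h2 2]
  have b3 : ‖y 0‖ * (‖y 1‖ * ‖x 2 - y 2‖) ≤ 1 * (1 * prec n T) := by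
    gcongr; exacts [h1 0, h1 1, h 2]
  linarith

theorem norm_exactOp_le (r : RoundCoins n T) (a b : Fin 3 → Fin 2) : ‖exactOp r a b‖ ≤ 1 := by
  simp only [exactOp, tensor3, norm_prod]
  exact Finset.prod_le_one (fun _ _ => norm_nonneg _) fun j _ => norm_sampledUnitary_le _ _ _

theorem norm_roundOp_le (hT : 1 ≤ T)
    (htrunc : ∀ q, IsTruncation (prec n T) (trunc q) (sampledUnitary q))
    (r : RoundCoins n T) (a b : Fin 3 → Fin 2) : ‖roundOp trunc r a b‖ ≤ 8 := by
  have h := norm_add_le (roundOp trunc r a b - exactOp r a b) (exactOp r a b)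
  rw [sub_add_cancel] at h
  linarith [norm_roundOp_sub_exactOp_le hT htrunc r a b, norm_exactOp_le r a b,
    prec_le_one (n := n) hT]

/-! ### Propagation of the error in one round -/

theorem qubitLoss_ge (hT : 1 ≤ T) : 520 ≤ qubitLoss T ^ 3 * chi T := by
  have h := one_le_cast hT
  have e : qubitLoss T ^ 3 * chi T = 60 ^ 12 / (2 * 36 ^ 2) ^ 3 * (T : ℝ) ^ 3 := by
    unfold qubitLoss angleLoss chi
    field_simp
  rw [e]
  have : (1 : ℝ) ≤ (T : ℝ) ^ 3 := one_le_pow₀ h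
  norm_num
  linarith

/-- Everything is measured by the largest entry `m` of `E`. The trace error is at most `64 * m`,
since `M' - M` is `E` times a unitary. The discrepancy in the next check is at least `qubitLoss T ^
3 * m` up to truncation errors, which split into a part below the tolerance and a part proportional
to `m`. A bound on just one of `M'` and `M` suffices, as they differ by at most `8 * m` entrywise.
-/
theorem error_propagation (hn : 1 ≤ n) (hT : 1 ≤ T)
    (htrunc : ∀ q, IsTruncation (prec n T) (trunc q) (sampledUnitary q))
    (g : Matrix.unitaryGroup (Fin 3 → Fin 2) ℂ) {g' : Op3}
    (hg' : IsTruncation (prec n T) g' (g⁻¹ : Matrix.unitaryGroup (Fin 3 → Fin 2) ℂ))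
    (r : RoundCoins n T) (M' M : Op3)
    (hM : (∀ a b, ‖M' a b‖ ≤ 2 ^ n) ∨ ∀ a b, ‖M a b‖ ≤ 2 ^ n)
    (hgood : ∀ a b, qubitLoss T ^ 3 *
        ‖((M' - M) * (g⁻¹ : Matrix.unitaryGroup (Fin 3 → Fin 2) ℂ)) a b‖
      ≤ ‖((M' - M) * (g⁻¹ : Matrix.unitaryGroup (Fin 3 → Fin 2) ℂ) * exactOp r).trace‖) :
    8 * ‖M'.trace - M.trace‖ ≤ chi T * (‖(M' * g' * roundOp trunc r).trace
      - (M * ((g⁻¹ : Matrix.unitaryGroup (Fin 3 → Fin 2) ℂ) * roundOp trunc r)).trace‖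
        + tol n T) := by
  set h : Op3 := ((g⁻¹ : Matrix.unitaryGroup (Fin 3 → Fin 2) ℂ) : Op3) with hh
  have hhg : h * (g : Op3) = 1 := by
    rw [hh, ← Submonoid.coe_mul, inv_mul_cancel, Submonoid.coe_one]
  set E := (M' - M) * h with hE
  have hξ := prec_pos (n := n) hT
  obtain ⟨p, hp⟩ := Finite.exists_max (fun p : (Fin 3 → Fin 2) × (Fin 3 → Fin 2) => ‖E p.1 p.2‖)
  set m := ‖E p.1 p.2‖ with hm
  have hm0 : 0 ≤ m := norm_nonneg _
  have hEm : ∀ a b, ‖E a b‖ ≤ m := fun a b => hp (a, b)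
  have hD : M' - M = E * (g : Op3) := by rw [hE, Matrix.mul_assoc, hhg, mul_one]
  have hg1 : ∀ a b, ‖(g : Op3) a b‖ ≤ 1 := entry_norm_bound_of_unitary g.2
  have hDm : ∀ a b, ‖(M' - M) a b‖ ≤ 8 * m := fun a b => by
    have := norm_mul_apply_le hm0 hEm hg1 a b
    rwa [← hD, mul_one] at this
  have hM' : ∀ a b, ‖M' a b‖ ≤ 2 ^ n + 8 * m := by
    intro a b
    rcases hM with hM | hM
    · linarith [hM a b]
    · have := norm_add_le (M a b) ((M' - M) a b)
      rw [Matrix.sub_apply, add_sub_cancel] at this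
      have h2 := hDm a b
      rw [Matrix.sub_apply] at h2
      linarith [hM a b]
  have htr : ‖M'.trace - M.trace‖ ≤ 64 * m := by
    rw [← Matrix.trace_sub]
    linarith [norm_trace_le hDm]
  set u := exactOp r
  set v := roundOp trunc r
  have e : (M' * g' * v).trace - (M * (h * v)).trace
      = (E * u).trace + (E * (v - u)).trace + (M' * (g' - h) * v).trace := by
    rw [hE]
    simp only [mul_sub, sub_mul, Matrix.trace_sub, Matrix.mul_assoc]
    ring
  have t1 : ‖(E * (v - u)).trace‖ ≤ 64 * (m * (7 * prec n T)) :=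
    norm_trace_mul_le hm0 hEm (norm_roundOp_sub_exactOp_le hT htrunc r)
  have t2 : ‖(M' * (g' - h) * v).trace‖
      ≤ 64 * (8 * ((2 ^ n + 8 * m) * prec n T) * 8) :=
    norm_trace_mul_le (by positivity) (norm_mul_apply_le (by positivity) hM' hg')
      (norm_roundOp_le hT htrunc r)
  have t3 : qubitLoss T ^ 3 * m ≤ ‖(E * u).trace‖ := hgood p.1 p.2
  have t4 : ‖(E * u).trace‖ ≤ ‖(M' * g' * v).trace - (M * (h * v)).trace‖
      + ‖(E * (v - u)).trace‖ + ‖(M' * (g' - h) * v).trace‖ := by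
    have : (E * u).trace = ((M' * g' * v).trace - (M * (h * v)).trace)
        - (E * (v - u)).trace - (M' * (g' - h) * v).trace := by rw [e]; ring
    rw [this]
    exact (norm_sub_le _ _).trans (add_le_add_left (norm_sub_le _ _) _)
  set X := ‖(M' * g' * v).trace - (M * (h * v)).trace‖
  -- Here `1 ≤ n` is needed, for `n + 12 ≤ 2 * n + 11`.
  have t5 : 2 ^ 12 * 2 ^ n * prec n T ≤ tol n T := by
    refine le_trans ?_ (prec_mul_le hT)
    rw [← pow_add]
    exact mul_le_mul_of_nonneg_right (pow_le_pow_right₀ (by norm_num) (by omega)) hξ.le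
  have t6 : qubitLoss T ^ 3 * m ≤ X + tol n T + 2 ^ 16 * (m * prec n T) := by
    have : 0 ≤ m * prec n T := by positivity
    nlinarith
  have hχ := chi_pos hT
  have t7 := mul_le_mul_of_nonneg_right t6 hχ.le
  have t8 := mul_le_mul_of_nonneg_left (qubitLoss_ge hT) hm0
  have t9 := mul_le_mul_of_nonneg_left (prec_mul_chi_le (n := n) hT) hm0
  -- With `520 * m` on the left and at most `m` lost to truncation, more than `8 * 64 * m` remains.
  nlinarith

/-! ### The soundness error of a deterministic prover -/

variable (g trunc) (P : Strategy n T) (c : Coins n T)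

/-- The message of the honest prover, computed with the truncated unitaries. -/
def honest (i : Fin T) : Op3 :=
  ptrace (g i).qubits (hybrid (fun k => expand (g k).qubits (roundOp trunc (c k)))
    (fun k => expand (g k).qubits (g k).op) i)

/-- The deviation of the prover from the honest one, times the inverse gate. -/
def deviation (i : Fin T) : Op3 :=
  (message P c i - honest g trunc c i) *
    ((((g i).op)⁻¹ : Matrix.unitaryGroup (Fin 3 → Fin 2) ℂ) : Op3)

/-- The verifier's choice `r` hides the deviation in the round after the message `i`. -/
def Lucky (i : Fin T) (r : RoundCoins n T) : Prop :=
  ∃ a b, ‖(deviation g trunc P c i * exactOp r).trace‖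
    < qubitLoss T ^ 3 * ‖deviation g trunc P c i a b‖

/-- Message `i`, honest or not, is fixed before the coins with index `i` are drawn. -/
theorem deviation_update (i : Fin T) (r : RoundCoins n T) :
    deviation g trunc P (Function.update c i r) i = deviation g trunc P c i := by
  have h1 : message P (Function.update c i r) i = message P c i := by
    unfold message
    congr 1
    ext1 j
    exact Function.update_of_ne (Fin.ne_of_lt j.2) _ _
  have h2 : honest g trunc (Function.update c i r) i = honest g trunc c i := by
    unfold honest
    congr 1
    refine hybrid_congr _ _ fun k hk => ?_
    rw [Function.update_of_ne (Fin.ne_of_lt hk)]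
  rw [deviation, deviation, h1, h2]

theorem densityLE_lucky (hT : 1 ≤ T) (i : Fin T) :
    DensityLE (fun c => Lucky g trunc P c i (c i)) (1 / (3 * T)) := by
  refine DensityLE.pi i fun c => ?_
  simp only [Lucky, deviation_update, Function.update_self]
  -- Luck at any entry implies luck at the largest one, so no union bound over entries is needed.
  obtain ⟨p, hp⟩ := Finite.exists_max
    (fun p : (Fin 3 → Fin 2) × (Fin 3 → Fin 2) => ‖deviation g trunc P c i p.1 p.2‖)
  refine (densityLE_round hT (deviation g trunc P c i) p.1 p.2).mono ?_ le_rfl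
  rintro r ⟨a, b, hab⟩
  have := qubitLoss_pos hT
  exact hab.trans_le (mul_le_mul_of_nonneg_left (hp (a, b)) (by positivity))

variable {g trunc P c}

theorem trace_honest_mul (i : Fin T) :
    (honest g trunc c i * ((((g i).op)⁻¹ : Matrix.unitaryGroup (Fin 3 → Fin 2) ℂ)
        * roundOp trunc (c i))).trace
      = (hybrid (fun k => expand (g k).qubits (roundOp trunc (c k)))
          (fun k => expand (g k).qubits (g k).op) (i + 1)).trace := by
  rw [honest, trace_ptrace_mul]
  refine trace_hybrid_succ _ _ i _ ?_
  rw [expand_mul, ← Matrix.mul_assoc, ← Submonoid.coe_mul, mul_inv_cancel, Submonoid.coe_one,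
    Matrix.one_mul]

theorem trace_honest (i : Fin T) : (honest g trunc c i).trace
    = (hybrid (fun k => expand (g k).qubits (roundOp trunc (c k)))
          (fun k => expand (g k).qubits (g k).op) i).trace :=
  trace_ptrace _ _

theorem norm_honest_le {i : Fin T} (hi : (i : ℕ) = 0) (a b : Fin 3 → Fin 2) :
    ‖honest g trunc c i a b‖ ≤ 2 ^ n := by
  rw [honest, hi, hybrid_zero]
  exact norm_ptrace_zeroProj_mul_le _
    (descProd_mem_unitaryGroup fun k => expand_mem_unitaryGroup _ (g k).op.2) a b

theorem exists_lucky_of_accepts (hT : 1 ≤ T) {C : ℂ} (hC : gap n ≤ ‖(topRow g).trace - C‖)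
    (htrunc : ∀ q, IsTruncation (prec n T) (trunc q) (sampledUnitary q))
    {gInv : Fin T → Op3} (hgInv : ∀ i, IsTruncation (prec n T)
      (gInv i) (((g i).op)⁻¹ : Matrix.unitaryGroup (Fin 3 → Fin 2) ℂ))
    (hacc : Accepts g C trunc gInv P c) : ∃ i, Lucky g trunc P c i (c i) := by
  by_contra hcon
  push Not at hcon
  obtain ⟨h0, hmid, hlast⟩ := hacc
  have hn : 1 ≤ n := by
    have := (g ⟨0, hT⟩).qubits 0
    exact this.pos
  have hχ := one_le_chi hT
  have hμ := tol_pos (n := n) hT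
  have step : ∀ i : Fin T, 8 * ‖(message P c i).trace - (honest g trunc c i).trace‖
      ≤ chi T * (‖(message P c i * gInv i * roundOp trunc (c i)).trace
        - (hybrid (fun k => expand (g k).qubits (roundOp trunc (c k)))
          (fun k => expand (g k).qubits (g k).op) (i + 1)).trace‖ + tol n T) := by
    intro i
    have hgood := hcon i
    unfold Lucky at hgood
    push Not at hgood
    rw [← trace_honest_mul]
    refine error_propagation hn hT htrunc (g i).op (hgInv i) (c i) _ _ ?_ hgood
    -- The verifier does not bound the entries of the first message; there the honest message is
    -- bounded instead, being built from exact unitaries only.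
    rcases Nat.eq_zero_or_pos (i : ℕ) with hi | hi
    · exact Or.inr (norm_honest_le hi)
    · exact Or.inl (hmid ⟨i - 1, by omega⟩ i (by simp; omega)).2
  -- Initially the error is at least `4 χ^T μ - μ`. A round turns the factor 3 into `8 * 3 = 24`,
  -- divides by `χ` and costs `2 μ`, which leaves at least 3 again.
  have claim : ∀ k : ℕ, ∀ hk : k < T, 3 * chi T ^ (T - k) * tol n T
      ≤ ‖(message P c ⟨k, hk⟩).trace - (honest g trunc c ⟨k, hk⟩).trace‖ := by
    intro k
    induction k with
    | zero =>
      intro hk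
      have h1 := h0 ⟨0, hk⟩ rfl
      have h2 : (honest g trunc c ⟨0, hk⟩).trace = (topRow g).trace := by
        rw [trace_honest, hybrid_zero]; rfl
      have h3 := norm_sub_le_norm_sub_add_norm_sub (topRow g).trace
        (message P c ⟨0, hk⟩).trace C
      rw [norm_sub_rev C] at h1
      rw [gap_eq hT] at hC
      rw [h2, norm_sub_rev]
      have h4 : 1 ≤ chi T ^ T := one_le_pow₀ hχ
      rw [Nat.sub_zero]
      nlinarith
    | succ k ih =>
      intro hk
      have h1 := ih (by omega)
      have h2 := step ⟨k, by omega⟩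
      have h3 := (hmid ⟨k, by omega⟩ ⟨k + 1, hk⟩ rfl).1
      have h4 := trace_honest (g := g) (trunc := trunc) (c := c) ⟨k + 1, hk⟩
      simp only at h2 h4
      rw [← h4] at h2
      have h5 := norm_sub_le_norm_sub_add_norm_sub
        (message P c ⟨k, by omega⟩ * gInv ⟨k, by omega⟩ * roundOp trunc (c ⟨k, by omega⟩)).trace
        (message P c ⟨k + 1, hk⟩).trace (honest g trunc c ⟨k + 1, hk⟩).trace
      rw [norm_sub_rev] at h3
      have h6 : T - k = T - (k + 1) + 1 := by omega
      rw [h6, pow_succ] at h1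
      have h7 : 1 ≤ chi T ^ (T - (k + 1)) := one_le_pow₀ hχ
      set d := ‖(message P c ⟨k + 1, hk⟩).trace - (honest g trunc c ⟨k + 1, hk⟩).trace‖
      have h8 : chi T * (24 * chi T ^ (T - (k + 1)) * tol n T) ≤ chi T * (d + 2 * tol n T) := by
        calc _ ≤ _ := by linarith
          _ ≤ _ := h2
          _ ≤ _ := mul_le_mul_of_nonneg_left (by linarith) (zero_le_one.trans hχ)
      have h9 := le_of_mul_le_mul_left h8 (zero_lt_one.trans_le hχ)
      nlinarith
  obtain ⟨t, rfl⟩ : ∃ t, T = t + 1 := ⟨T - 1, by omega⟩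
  have h1 := claim t (by omega)
  have h2 := step ⟨t, by omega⟩
  have h3 := hlast ⟨t, by omega⟩ rfl
  simp only at h2
  rw [hybrid_last] at h2
  rw [norm_sub_rev] at h3
  rw [show t + 1 - t = 1 by omega, pow_one] at h1
  -- The last hybrid is the verifier's own quantity, so the final check bounds the discrepancy by
  -- `μ`; this gives the contradiction `24 μ ≤ 2 μ`.
  have h4 : chi (t + 1) * (24 * tol n (t + 1)) ≤ chi (t + 1) * (2 * tol n (t + 1)) := by
    calc _ ≤ _ := by linarith
      _ ≤ _ := h2
      _ ≤ _ := mul_le_mul_of_nonneg_left (by linarith) (zero_le_one.trans hχ)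
  have h5 := le_of_mul_le_mul_left h4 (zero_lt_one.trans_le hχ)
  linarith

theorem densityLE_accepts (hT : 1 ≤ T) {C : ℂ} (hC : gap n ≤ ‖(topRow g).trace - C‖)
    (htrunc : ∀ q, IsTruncation (prec n T) (trunc q) (sampledUnitary q))
    {gInv : Fin T → Op3} (hgInv : ∀ i, IsTruncation (prec n T)
      (gInv i) (((g i).op)⁻¹ : Matrix.unitaryGroup (Fin 3 → Fin 2) ℂ)) (P : Strategy n T) :
    DensityLE (fun c => Accepts g C trunc gInv P c) (1 / 3) := by
  refine (DensityLE.exists fun i => densityLE_lucky g trunc P hT i).mono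
    (fun c hc => exists_lucky_of_accepts hT hC htrunc hgInv hc) ?_
  have := one_le_cast hT
  rw [Fintype.card_fin]
  apply le_of_eq
  field_simp

/-! ### Randomized provers -/

theorem uniformOn_univ_le {α : Type*} [Fintype α] [MeasurableSpace α] [MeasurableSingletonClass α]
    {Q : α → Prop} {p : ℝ} (h : DensityLE Q p) :
    uniformOn (Set.univ : Set α) {x | Q x} ≤ ENNReal.ofReal p := by
  classical
  rw [uniformOn_univ, Measure.count_apply_finite _ (Set.toFinite _)]
  refine ENNReal.div_le_of_le_mul ?_
  have h1 : ((Set.toFinite {x | Q x}).toFinset.card : ℝ) ≤ p * Fintype.card α := by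
    refine le_of_eq_of_le ?_ h
    congr 2
    ext x
    simp
  rcases isEmpty_or_nonempty α with hα | hα
  · simp
  have hp : 0 ≤ p := by
    have h2 : (0 : ℝ) ≤ p * Fintype.card α := (Nat.cast_nonneg _).trans h1
    exact nonneg_of_mul_nonneg_left h2 (by exact_mod_cast Fintype.card_pos)
  rw [← ENNReal.ofReal_natCast, ← ENNReal.ofReal_natCast, ← ENNReal.ofReal_mul hp]
  exact ENNReal.ofReal_le_ofReal h1

theorem measurableSet_accepts {C : ℂ} {gInv : Fin T → Op3} {Ω : Type*} [MeasurableSpace Ω]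
    {P : Ω → Strategy n T} (hP : ∀ i h a b, Measurable (fun ω => P ω i h a b)) (c : Coins n T) :
    MeasurableSet {ω | Accepts g C trunc gInv (P ω) c} := by
  have hm : ∀ i a b, Measurable fun ω => message (P ω) c i a b := fun i a b => hP _ _ _ _
  have ht : ∀ i, Measurable fun ω => (message (P ω) c i).trace := fun i => by
    simp only [Matrix.trace, Matrix.diag]
    exact Finset.measurable_sum _ fun a _ => hm i a a
  have ht' : ∀ i, Measurable fun ω =>
      (message (P ω) c i * gInv i * roundOp trunc (c i)).trace := fun i => by
    simp only [Matrix.trace, Matrix.diag, Matrix.mul_apply]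
    exact Finset.measurable_sum _ fun a _ => Finset.measurable_sum _ fun b _ =>
      (Finset.measurable_sum _ fun d _ => (hm i a d).mul_const _).mul_const _
  have hle : ∀ {f : Ω → ℂ} (x : ℝ), Measurable f → Measurable fun ω => ‖f ω‖ ≤ x := fun x hf =>
    measurableSet_setOfPred.1 (measurableSet_le hf.norm measurable_const)
  refine measurableSet_setOfPred.2 (Measurable.and ?_ (Measurable.and ?_ ?_))
  · exact Measurable.forall fun i => Measurable.forall fun _ => hle _ ((ht i).const_sub C)
  · exact Measurable.forall fun i => Measurable.forall fun j => Measurable.forall fun _ =>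
      (hle _ ((ht j).sub (ht' i))).and
        (Measurable.forall fun a => Measurable.forall fun b => hle _ (hm j a b))
  · exact Measurable.forall fun i => Measurable.forall fun _ => hle _ ((ht' i).const_sub _)

end TopRowProtocol

end

theorem mainTheorem6 (n T : ℕ) (hT : 1 ≤ T)
    (g : Fin T → TopRowProtocol.LocalGate n) (C : ℂ)
    (hC : TopRowProtocol.gap n ≤ ‖(TopRowProtocol.topRow g).trace - C‖)
    (trunc : TopRowProtocol.QubitCoins n T → Matrix (Fin 2) (Fin 2) ℂ)
    (htrunc : ∀ q, TopRowProtocol.IsTruncation (TopRowProtocol.prec n T)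
      (trunc q) (TopRowProtocol.sampledUnitary q))
    (gInv : Fin T → TopRowProtocol.Op3)
    (hgInv : ∀ i, TopRowProtocol.IsTruncation (TopRowProtocol.prec n T)
      (gInv i) (((g i).op)⁻¹ : Matrix.unitaryGroup (Fin 3 → Fin 2) ℂ))
    {Ω : Type*} [MeasurableSpace Ω] (ρ : MeasureTheory.Measure Ω)
    [MeasureTheory.IsProbabilityMeasure ρ]
    (P : Ω → TopRowProtocol.Strategy n T)
    (hP : ∀ i h a b, Measurable (fun ω => P ω i h a b)) :
    TopRowProtocol.passProb g C trunc gInv ρ P ≤ 1 / 3 := by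
  have hmeas : MeasurableSet {p : Ω × TopRowProtocol.Coins n T |
      TopRowProtocol.Accepts g C trunc gInv (P p.1) p.2} := by
    -- There are finitely many coins, so measurability in the seed for each fixed coin sequence is
    -- enough.
    have e : {p : Ω × TopRowProtocol.Coins n T |
        TopRowProtocol.Accepts g C trunc gInv (P p.1) p.2}
        = ⋃ c, {ω | TopRowProtocol.Accepts g C trunc gInv (P ω) c} ×ˢ {c} := by
      ext ⟨ω, c⟩
      simp
    rw [e]
    exact MeasurableSet.iUnion fun c =>
      (TopRowProtocol.measurableSet_accepts hP c).prod (measurableSet_singleton c)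
  rw [TopRowProtocol.passProb, Measure.prod_apply hmeas]
  calc ∫⁻ ω, uniformOn Set.univ (Prod.mk ω ⁻¹' {p : Ω × TopRowProtocol.Coins n T |
          TopRowProtocol.Accepts g C trunc gInv (P p.1) p.2}) ∂ρ
      ≤ ∫⁻ _, ENNReal.ofReal (1 / 3) ∂ρ := by
        -- For a fixed seed the prover is deterministic, and the bound holds pointwise.
        refine lintegral_mono fun ω => ?_
        exact TopRowProtocol.uniformOn_univ_le
          (TopRowProtocol.densityLE_accepts hT hC htrunc hgInv (P ω))
    _ = 1 / 3 := by
        rw [lintegral_const, measure_univ, mul_one, ENNReal.ofReal_div_of_pos (by norm_num)]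
        simp
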